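/- Let $\beta>0$ and let $g$ be a real-valued function defined on a neighborhood of $+\infty$. For $t$ large and $0<|x|<1$ with $g(t)\neq 0$ put $$\Delta^1_{t,x}g=\operatorname{sign}(x)\,\frac{g(t(1-x))-g(t)}{|x|\,g(t)}.$$ The following three conditions are equivalent. (i) $g$ is ultimately nonzero and $\displaystyle\lim_{\delta\to0+}\limsup_{t\to\infty}\sup_{0<|x|<\delta}|\Delta^1_{t,x}g-\beta|=0$. (ii) $g$ is normalized regularly varying of index $-\beta$, that is, there are $a>0$, a constant $c\neq0$ and a function $\epsilon$ with $\epsilon(u)\to0$ as $u\to\infty$ and $\epsilon(u)/u$ integrable on $[a,t]$ for every $t\ge a$, such that $g(t)=t^{-\beta}\,c\,\exp\int_a^t\frac{\epsilon(u)}{u}\,du$ for all $t\ge a$. (iii) $g(t)\to0$ as $t\to\infty$, $g$ is ultimately absolutely continuous (on some half-line $[a,\infty)$ it is absolutely continuous on every compact interval), and a version of its Radon–Nikodym derivative is regularly varying of index $-\beta-1$. Here a function $f$ is regularly varying of index $\rho$ if, on some neighborhood of infinity, it is Lebesgue measurable and either everywhere positive or everywhere negative, and $f(\lambda t)/f(t)\to\lambda^\rho$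 as $t\to\infty$ for every $\lambda>0$. -/

import Mathlib

open Filter Topology MeasureTheory

/-- The difference quotient `sign(x) (g(t(1-x)) - g(t)) / (|x|^r g(t))`. -/
noncomputable def smoothDelta (r : ℝ) (g : ℝ → ℝ) (t x : ℝ) : ℝ :=
  Real.sign x * (g (t * (1 - x)) - g t) / (|x| ^ r * g t)

/-- The difference-quotient condition with constant `β`: `g` is ultimately nonzero (so that the
quotients are defined) and
`lim_{δ → 0+} limsup_{t → ∞} sup_{0 < |x| < δ} |Δ¹_{t,x} g - β| = 0`.
The supremum and the limit superior are taken in `[0, ∞]`. -/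
def DeltaOne (g : ℝ → ℝ) (β : ℝ) : Prop :=
  (∀ᶠ t in atTop, g t ≠ 0) ∧
  Tendsto
    (fun δ : ℝ => limsup
      (fun t : ℝ => ⨆ x ∈ {x : ℝ | 0 < |x| ∧ |x| < δ},
        ENNReal.ofReal |smoothDelta 1 g t x - β|) atTop)
    (𝓝[>] 0) (𝓝 0)

/-- `f` is regularly varying (at infinity) of index `ρ`: on some half-line `[a, ∞)` it is Lebesgue
measurable and of constant strict sign, and `f(λt)/f(t) → λ^ρ` as `t → ∞` for every `λ > 0`. -/
def RegularlyVarying (f : ℝ → ℝ) (ρ : ℝ) : Prop :=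
  (∃ a : ℝ, AEMeasurable f (volume.restrict (Set.Ici a)) ∧
    ((∀ t ≥ a, 0 < f t) ∨ (∀ t ≥ a, f t < 0))) ∧
  ∀ l : ℝ, 0 < l → Tendsto (fun t => f (l * t) / f t) atTop (𝓝 (l ^ ρ))

/-- `g` is normalized regularly varying of index `ρ`: on some half-line `[a, ∞)`, `a > 0`,
`g(t) = t^ρ c exp(∫_a^t ε(u)/u du)` with a constant `c ≠ 0` and `ε(u) → 0` as `u → ∞`. -/
def NormalizedRegularlyVarying (g : ℝ → ℝ) (ρ : ℝ) : Prop :=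
  ∃ a : ℝ, 0 < a ∧ ∃ c : ℝ, c ≠ 0 ∧ ∃ ε : ℝ → ℝ,
    Tendsto ε atTop (𝓝 0) ∧
    (∀ t ≥ a, IntervalIntegrable (fun u => ε u / u) volume a t) ∧
    ∀ t ≥ a, g t = t ^ ρ * c * Real.exp (∫ u in a..t, ε u / u)

/-- `f` is (a version of) the Radon–Nikodym derivative of `g` on `[a, ∞)`: it is locally integrable
there and its integral over every `[s, t]` is the increment of `g`. -/
def IsDensityOn (g f : ℝ → ℝ) (a : ℝ) : Prop :=
  ∀ s ≥ a, ∀ t ≥ s, IntervalIntegrable f volume s t ∧ g t - g s = ∫ u in s..t, f u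

/-- `g` is ultimately absolutely continuous, and a version of its Radon–Nikodym derivative is
regularly varying of index `ρ`. -/
def UltimatelyACWithRVDensity (g : ℝ → ℝ) (ρ : ℝ) : Prop :=
  ∃ a : ℝ, (∀ b ≥ a, AbsolutelyContinuousOnInterval g a b) ∧
    ∃ f : ℝ → ℝ, IsDensityOn g f a ∧ RegularlyVarying f ρ

/-! The implications run in a cycle. From (i), write `k = log |g| + β log`. Since `g(t(1-x)) / g(t)
= 1 + xD` with `D` near `β`, second-order bounds on the logarithm show that near `t` the function
`k` is Lipschitz with constant `η/t`, for any prescribed `η` once `t` is large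
(`DeltaOne.log_lipschitz`). Hence `k` is absolutely continuous, and `ε(u) = u k'(u)` tends to zero
and gives the representation.

From (ii), differentiating the representation almost everywhere gives the density `g(u)(ε(u) -
β)/u`, whose sign and regular variation are visible.

From (iii), let `f > 0` be the density. The uniform convergence theorem
(`eventually_forall_abs_sub_le`) makes `f` nearly constant on `[t(1-δ), t(1+δ)]`, so `g(t(1-x)) -
g(t)` is close to `-x t f(t)`. Karamata's theorem (`eventually_abs_neg_mul_sub_le`), obtained by
summing over doublings of `t`, gives `t f(t) ~ -β g(t)`. Together these are (i). -/

/-- A transitive relation that holds between points of `[a, ∞)` at distance at most `d` holds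
between all points of `[a, ∞)`. -/
theorem rel_of_rel_of_le_add {R : ℝ → ℝ → Prop} (htrans : ∀ x y z, R x y → R y z → R x z)
    {a d : ℝ} (hd : 0 < d) (hloc : ∀ s t, a ≤ s → s ≤ t → t ≤ s + d → R s t) :
    ∀ s t, a ≤ s → s ≤ t → R s t := by
  have key : ∀ n : ℕ, ∀ s t, a ≤ s → s ≤ t → t ≤ s + n * d + d → R s t := by
    intro n
    induction n with
    | zero => intro s t h1 h2 h3; exact hloc s t h1 h2 (by simpa using h3)
    | succ n ih =>
      intro s t h1 h2 h3
      by_cases h : t ≤ s + d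
      · exact hloc s t h1 h2 h
      · push Not at h
        refine htrans s (s + d) t (hloc _ _ h1 (by linarith) le_rfl)
          (ih _ _ (by linarith) h.le ?_)
        push_cast at h3
        linarith
  intro s t h1 h2
  obtain ⟨n, hn⟩ := exists_nat_ge ((t - s) / d)
  rw [div_le_iff₀ hd] at hn
  exact key n s t h1 h2 (by linarith)

/-! ### From difference quotients to the exponential representation -/

theorem smoothDelta_one (g : ℝ → ℝ) (t : ℝ) {x : ℝ} (hx : x ≠ 0) :
    smoothDelta 1 g t x = (g (t * (1 - x)) - g t) / (x * g t) := by
  unfold smoothDelta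
  rcases lt_or_gt_of_ne hx with h | h
  · rw [Real.sign_of_neg h, abs_of_neg h, Real.rpow_one, neg_one_mul, neg_mul, neg_div_neg_eq]
  · rw [Real.sign_of_pos h, abs_of_pos h, Real.rpow_one, one_mul]

/-- The supremum decreases with `δ`, so one good `δ` for each `η` already gives the limit. -/
theorem deltaOne_iff {g : ℝ → ℝ} {β : ℝ} :
    DeltaOne g β ↔ (∀ᶠ t in atTop, g t ≠ 0) ∧
      ∀ η > 0, ∃ δ > 0, ∀ᶠ t in atTop, ∀ x : ℝ, 0 < |x| → |x| < δ →
        |smoothDelta 1 g t x - β| ≤ η := by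
  unfold DeltaOne
  refine and_congr_right fun _ => ⟨fun h η hη => ?_, fun h => ?_⟩
  · have h1 := h.eventually (gt_mem_nhds (ENNReal.ofReal_pos.2 hη))
    obtain ⟨δ, h2, hδ⟩ := (h1.and self_mem_nhdsWithin).exists
    refine ⟨δ, hδ, ?_⟩
    filter_upwards [eventually_lt_of_limsup_lt h2] with t ht x hx0 hx
    have h3 := (le_iSup₂ (f := fun x (_ : x ∈ {x : ℝ | 0 < |x| ∧ |x| < δ}) =>
      ENNReal.ofReal |smoothDelta 1 g t x - β|) x ⟨hx0, hx⟩).trans ht.le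
    exact (ENNReal.ofReal_le_ofReal_iff hη.le).1 h3
  · rw [ENNReal.tendsto_nhds_zero]
    intro e he
    obtain ⟨r, hr0, hr⟩ := ENNReal.lt_iff_exists_nnreal_btwn.1 he
    obtain ⟨δ, hδ, h1⟩ := h r (by exact_mod_cast hr0)
    filter_upwards [Ioo_mem_nhdsGT hδ] with d hd
    refine limsup_le_of_le (h := ?_)
    filter_upwards [h1] with t ht
    refine iSup₂_le fun x hx => le_trans ?_ hr.le
    rw [← ENNReal.ofReal_coe_nnreal]
    exact ENNReal.ofReal_le_ofReal (ht x hx.1 (hx.2.trans hd.2))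

theorem abs_add_log_one_sub_le {x : ℝ} (hx : |x| ≤ 1 / 2) : |x + Real.log (1 - x)| ≤ 2 * x ^ 2 := by
  have h := Real.abs_log_sub_add_sum_range_le (x := x) (by linarith) 1
  simp only [Finset.sum_range_one, Nat.cast_zero, zero_add, pow_one, div_one, Nat.reduceAdd] at h
  refine h.trans ?_
  rw [div_le_iff₀ (by linarith), sq_abs]
  nlinarith [sq_nonneg x]

/-- Under the difference-quotient condition, `g` has locally constant sign and
`log |g| + β log` has a small local logarithmic Lipschitz constant near infinity. -/
theorem DeltaOne.log_lipschitz {g : ℝ → ℝ} {β : ℝ} (hβ : 0 < β) (h : DeltaOne g β) {η : ℝ}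
    (hη : 0 < η) : ∃ δ > 0, ∃ T > 0, ∀ t ≥ T, ∀ s, |s - t| ≤ δ * t → 0 < g s * g t ∧
      |(Real.log |g s| + β * Real.log s) - (Real.log |g t| + β * Real.log t)|
        ≤ η / t * |s - t| := by
  obtain ⟨hne, h⟩ := deltaOne_iff.1 h
  obtain ⟨δ₁, hδ₁, h1⟩ := h (η / 2) (by positivity)
  obtain ⟨T, hT⟩ := eventually_atTop.1 (h1.and hne)
  set B := β + η / 2 with hB
  have hBpos : 0 < B := by positivity
  -- `B` bounds `|D|`. The terms give in turn: the strict bound `|x| < δ₁`, `|x| ≤ 1/2`, `|xD| ≤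
  -- 1/2`, and quadratic errors `(2B² + 2β)x²` of at most `η|x|/2`.
  set δ := min (δ₁ / 2) (min (1 / 2) (min (1 / (2 * B)) (η / (2 * (2 * B ^ 2 + 2 * β)))))
  have hδ : 0 < δ := by positivity
  refine ⟨δ, hδ, max T 1, by positivity, fun t ht s hs => ?_⟩
  have htpos : 0 < t := by linarith [le_max_right T 1]
  obtain ⟨ht1, ht0⟩ := hT t ((le_max_left _ _).trans ht)
  rcases eq_or_ne s t with rfl | hst
  · simpa using mul_self_pos.2 ht0
  obtain ⟨x, rfl⟩ : ∃ x, s = t * (1 - x) := ⟨1 - s / t, by field_simp; ring⟩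
  have hx0 : x ≠ 0 := by rintro rfl; simp at hst
  have e1 : t * (1 - x) - t = -(t * x) := by ring
  have hxa : η / t * |t * (1 - x) - t| = η * |x| := by
    rw [e1, abs_neg, abs_mul, abs_of_pos htpos]; field_simp
  rw [hxa]
  rw [e1, abs_neg, abs_mul, abs_of_pos htpos, mul_comm] at hs
  have hxδ : |x| ≤ δ := le_of_mul_le_mul_right hs htpos
  have hxpos : 0 < |x| := abs_pos.2 hx0
  have hδ1 : |x| < δ₁ := by
    have : δ ≤ δ₁ / 2 := min_le_left _ _
    linarith
  have hδ2 : |x| ≤ 1 / 2 := hxδ.trans ((min_le_right _ _).trans (min_le_left _ _))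
  have hδ3 : |x| ≤ 1 / (2 * B) := hxδ.trans
    ((min_le_right _ _).trans ((min_le_right _ _).trans (min_le_left _ _)))
  have hδ4 : |x| ≤ η / (2 * (2 * B ^ 2 + 2 * β)) := hxδ.trans
    ((min_le_right _ _).trans ((min_le_right _ _).trans (min_le_right _ _)))
  rw [le_div_iff₀ (by positivity)] at hδ3 hδ4
  have h2 := ht1 x hxpos hδ1
  rw [smoothDelta_one g t hx0] at h2
  set D := (g (t * (1 - x)) - g t) / (x * g t) with hD
  have hgs : g (t * (1 - x)) = g t * (1 - -(x * D)) := by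
    rw [hD]; field_simp; ring
  have hDB : |D| ≤ B := by
    have := abs_add_le (D - β) β
    rw [sub_add_cancel, abs_of_pos hβ] at this
    linarith
  have hy : |-(x * D)| ≤ |x| * B := by
    rw [abs_neg, abs_mul]; gcongr
  have hy2 : |-(x * D)| ≤ 1 / 2 := by nlinarith
  have h1y : 0 < 1 - -(x * D) := by linarith [le_abs_self (-(x * D))]
  have h1x : 0 < 1 - x := by linarith [le_abs_self x]
  refine ⟨?_, ?_⟩
  · rw [hgs]
    have := mul_self_pos.2 ht0
    nlinarith [mul_pos this h1y]
  · rw [hgs, abs_mul, Real.log_mul (abs_ne_zero.2 ht0) (abs_ne_zero.2 h1y.ne'), abs_of_pos h1y,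
      Real.log_mul htpos.ne' h1x.ne']
    have e2 := abs_add_log_one_sub_le hy2
    have e3 := abs_add_log_one_sub_le hδ2
    have e4 : Real.log |g t| + Real.log (1 - -(x * D)) + β * (Real.log t + Real.log (1 - x)) -
        (Real.log |g t| + β * Real.log t) = (-(x * D) + Real.log (1 - -(x * D))) +
        β * (x + Real.log (1 - x)) + x * (D - β) := by ring
    rw [e4]
    have e5 : |β * (x + Real.log (1 - x))| ≤ β * (2 * x ^ 2) := by
      rw [abs_mul, abs_of_pos hβ]; gcongr
    have e6 : |x * (D - β)| ≤ |x| * (η / 2) := by rw [abs_mul]; gcongr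
    have e7 : (-(x * D)) ^ 2 ≤ (|x| * B) ^ 2 := by
      rw [← sq_abs]; gcongr
    refine (abs_add_three _ _ _).trans ?_
    have e8 : x ^ 2 = |x| * |x| := by rw [← sq, sq_abs]
    have e9 : |x| * (|x| * (2 * (2 * B ^ 2 + 2 * β))) ≤ |x| * η := by gcongr
    rw [e8] at e5
    nlinarith

/-- Chaining the local estimates shows that `k` is Lipschitz on a whole half-line and that `g` keeps
its sign there; `k` is then the integral of its derivative. -/
theorem DeltaOne.normalizedRegularlyVarying {g : ℝ → ℝ} {β : ℝ} (hβ : 0 < β) (h : DeltaOne g β) :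
    NormalizedRegularlyVarying g (-β) := by
  set k : ℝ → ℝ := fun t => Real.log |g t| + β * Real.log t with hk
  obtain ⟨δ, hδ, T, hT, hloc⟩ := h.log_lipschitz hβ one_pos
  have hchain : ∀ s t, T ≤ s → s ≤ t → 0 < g s * g t ∧ |k t - k s| ≤ 1 / T * (t - s) := by
    -- The admissible step `δ * s` at `s ≥ T` is at least `δ * T`, so this step length works
    -- everywhere.
    refine rel_of_rel_of_le_add (d := δ * T) ?_ (by positivity) ?_
    · rintro x y z ⟨h1, h2⟩ ⟨h3, h4⟩
      refine ⟨?_, ?_⟩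
      · have h5 : 0 < (g x * g z) * (g y * g y) := by nlinarith [mul_pos h1 h3]
        exact pos_of_mul_pos_left h5 (mul_self_nonneg _)
      · have := abs_sub_le (k z) (k y) (k x)
        linarith
    · intro s t hs hst ht
      have hspos : 0 < s := hT.trans_le hs
      have habs : |t - s| = t - s := abs_of_nonneg (by linarith)
      have h1 := hloc s hs t (by rw [habs]; nlinarith)
      refine ⟨by rw [mul_comm]; exact h1.1, h1.2.trans ?_⟩
      rw [habs]
      have : 1 / s ≤ 1 / T := one_div_le_one_div_of_le hT hs
      exact mul_le_mul_of_nonneg_right this (by linarith)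
  have hac : ∀ t ≥ T, AbsolutelyContinuousOnInterval k T t := by
    intro t ht
    refine LipschitzOnWith.absolutelyContinuousOnInterval (K := (1 / T).toNNReal) ?_
    rw [Set.uIcc_of_le ht]
    refine LipschitzOnWith.of_dist_le_mul fun x hx y hy => ?_
    rw [Real.coe_toNNReal _ (by positivity), Real.dist_eq, Real.dist_eq]
    rcases le_total x y with hxy | hxy
    · rw [abs_sub_comm, abs_sub_comm x y, abs_of_nonneg (sub_nonneg.2 hxy)]
      exact (hchain x y hx.1 hxy).2
    · rw [abs_of_nonneg (sub_nonneg.2 hxy)]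
      exact (hchain y x hy.1 hxy).2
  have hcongr : ∀ t ≥ T, Set.EqOn (deriv k) (fun u => u * deriv k u / u) (Set.uIcc T t) := by
    intro t ht u hu
    rw [Set.uIcc_of_le ht] at hu
    have : u ≠ 0 := (hT.trans_le hu.1).ne'
    field_simp
  have hgT : g T ≠ 0 := fun h0 => by simpa [h0] using (hchain T T le_rfl le_rfl).1
  refine ⟨T, hT, SignType.sign (g T) * Real.exp (k T), ?_, fun u => u * deriv k u, ?_, ?_, ?_⟩
  · rcases lt_or_gt_of_ne hgT with h0 | h0 <;> simp [sign_neg, sign_pos, h0]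
  · rw [Metric.tendsto_atTop]
    intro e he
    obtain ⟨d, hd, S, hS, hl⟩ := h.log_lipschitz hβ (half_pos he)
    refine ⟨S, fun u hu => ?_⟩
    have hupos : 0 < u := hS.trans_le hu
    rw [dist_zero_right, norm_mul, Real.norm_of_nonneg hupos.le]
    -- The bound also covers points where `k` is not differentiable, because `deriv` is zero there;
    -- so `ε → 0` along all `u`, not merely almost all.
    have h1 : ‖deriv k u‖ ≤ e / 2 / u := by
      refine norm_deriv_le_of_lip' (by positivity) ?_
      filter_upwards [Metric.closedBall_mem_nhds u (mul_pos hd hupos)] with s hs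
      rw [Metric.mem_closedBall, Real.dist_eq] at hs
      exact (hl u hu s hs).2
    calc u * ‖deriv k u‖ ≤ u * (e / 2 / u) := by gcongr
      _ = e / 2 := by field_simp
      _ < e := by linarith
  · intro t ht
    exact ((hac t ht).intervalIntegrable_deriv).congr
      fun u hu => hcongr t ht (Set.uIoc_subset_uIcc hu)
  · intro t ht
    rw [← intervalIntegral.integral_congr (hcongr t ht), (hac t ht).integral_deriv_eq_sub,
      mul_assoc, mul_assoc, ← Real.exp_add, Real.rpow_def_of_pos (hT.trans_le ht), mul_left_comm,
      ← Real.exp_add]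
    have hp := (hchain T t le_rfl ht).1
    have hgt : g t ≠ 0 := fun h0 => by simp [h0] at hp
    have e : Real.log t * -β + (k T + (k t - k T)) = Real.log |g t| := by
      simp only [hk]; ring
    rw [e, Real.exp_log (abs_pos.2 hgt)]
    rcases lt_or_gt_of_ne hgT with h0 | h0
    · have : g t < 0 := by nlinarith
      rw [sign_neg h0, abs_of_neg this]; simp
    · have : 0 < g t := by nlinarith
      rw [sign_pos h0, abs_of_pos this]; simp

/-! ### From the representation to a regularly varying density -/

theorem AbsolutelyContinuousOnInterval.of_dist_le {X Y : Type*} [PseudoMetricSpace X]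
    [PseudoMetricSpace Y] {f : ℝ → X} {g : ℝ → Y} {a b : ℝ} (K : ℝ)
    (hf : AbsolutelyContinuousOnInterval f a b)
    (h : ∀ x ∈ Set.uIcc a b, ∀ y ∈ Set.uIcc a b, dist (g x) (g y) ≤ K * dist (f x) (f y)) :
    AbsolutelyContinuousOnInterval g a b := by
  unfold AbsolutelyContinuousOnInterval at hf ⊢
  have h0 := hf.const_mul K
  rw [mul_zero] at h0
  refine squeeze_zero' (Eventually.of_forall fun E => Finset.sum_nonneg fun i _ => dist_nonneg)
    ?_ h0
  filter_upwards [mem_inf_of_right (mem_principal_self _)] with E hE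
  rw [Finset.mul_sum]
  exact Finset.sum_le_sum fun i hi => h _ (hE.1 i hi).1 _ (hE.1 i hi).2

theorem AbsolutelyContinuousOnInterval.congr_uIcc {X : Type*} [PseudoMetricSpace X] {f g : ℝ → X}
    {a b : ℝ} (hf : AbsolutelyContinuousOnInterval f a b) (h : Set.EqOn g f (Set.uIcc a b)) :
    AbsolutelyContinuousOnInterval g a b :=
  hf.of_dist_le 1 fun x hx y hy => by rw [h hx, h hy, one_mul]

theorem AbsolutelyContinuousOnInterval.exp {f : ℝ → ℝ} {a b : ℝ}
    (hf : AbsolutelyContinuousOnInterval f a b) :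
    AbsolutelyContinuousOnInterval (fun x => Real.exp (f x)) a b := by
  obtain ⟨C, hC⟩ := hf.exists_bound
  refine hf.of_dist_le (Real.exp C) fun x hx y hy => ?_
  rw [Real.dist_eq, Real.dist_eq]
  refine (convex_Iic C).norm_image_sub_le_of_norm_deriv_le (f := Real.exp)
    (fun z _ => Real.differentiableAt_exp) (fun z hz => ?_)
    ((le_abs_self _).trans (hC y hy)) ((le_abs_self _).trans (hC x hx))
  rw [Real.deriv_exp, Real.norm_of_nonneg (Real.exp_pos _).le]
  exact Real.exp_le_exp.2 hz

section Representation

variable {g ε : ℝ → ℝ} {a c ρ : ℝ}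

theorem absolutelyContinuousOnInterval_of_representation (ha : 0 < a)
    (hint : ∀ t ≥ a, IntervalIntegrable (fun u => ε u / u) volume a t)
    (hg : ∀ t ≥ a, g t = t ^ ρ * c * Real.exp (∫ u in a..t, ε u / u)) {b : ℝ} (hb : a ≤ b) :
    AbsolutelyContinuousOnInterval g a b := by
  have h1 := ((hint b hb).absolutelyContinuousOnInterval_intervalIntegral
    Set.left_mem_uIcc).exp
  have h2 : AbsolutelyContinuousOnInterval (fun t : ℝ => t ^ ρ * c) a b := by
    refine ContDiffOn.absolutelyContinuousOnInterval fun t ht => ?_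
    rw [Set.uIcc_of_le hb] at ht
    exact ((Real.contDiffAt_rpow_const_of_ne (ha.trans_le ht.1).ne').mul
      contDiffAt_const).contDiffWithinAt
  refine (h2.mul h1).congr_uIcc fun t ht => ?_
  rw [Set.uIcc_of_le hb] at ht
  exact hg t ht.1

theorem ae_hasDerivAt_of_representation (ha : 0 < a)
    (hint : ∀ t ≥ a, IntervalIntegrable (fun u => ε u / u) volume a t)
    (hg : ∀ t ≥ a, g t = t ^ ρ * c * Real.exp (∫ u in a..t, ε u / u)) {b : ℝ} (hb : a ≤ b) :
    ∀ᵐ x, x ∈ Set.uIcc a b → HasDerivAt g (g x * (ε x + ρ) / x) x := by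
  -- The formula for `g` is known only on `[a, ∞)`, so a two-sided derivative needs `x > a`.
  have hne : ∀ᵐ x : ℝ, x ≠ a := by simp [ae_iff, measure_singleton]
  filter_upwards [(hint b hb).ae_hasDerivAt_integral, hne] with x hx hxa hxb
  have h1 := (hx hxb a Set.left_mem_uIcc).exp
  rw [Set.uIcc_of_le hb] at hxb
  have hax : a < x := lt_of_le_of_ne hxb.1 (Ne.symm hxa)
  have hx0 : 0 < x := ha.trans hax
  have h2 := (((Real.hasDerivAt_rpow_const (p := ρ) (Or.inl hx0.ne')).mul_const c).mul h1)
  refine (h2.congr_of_eventuallyEq ?_).congr_deriv ?_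
  · filter_upwards [Ioi_mem_nhds hax] with y hy
    exact hg y (le_of_lt hy)
  · rw [hg x hxb.1, Real.rpow_sub_one hx0.ne']
    ring

theorem isDensityOn_of_representation (ha : 0 < a)
    (hint : ∀ t ≥ a, IntervalIntegrable (fun u => ε u / u) volume a t)
    (hg : ∀ t ≥ a, g t = t ^ ρ * c * Real.exp (∫ u in a..t, ε u / u)) :
    IsDensityOn g (fun x => g x * (ε x + ρ) / x) a := by
  intro s hs t hst
  have hac := absolutelyContinuousOnInterval_of_representation ha hint hg (hs.trans hst)
  have hsub : Set.uIcc s t ⊆ Set.uIcc a t := by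
    rw [Set.uIcc_of_le hst, Set.uIcc_of_le (hs.trans hst)]
    exact Set.Icc_subset_Icc_left hs
  have hac' := hac.mono hsub
  have hd : ∀ᵐ x, x ∈ Set.uIoc s t → deriv g x = g x * (ε x + ρ) / x := by
    filter_upwards [ae_hasDerivAt_of_representation ha hint hg (hs.trans hst)] with x hx hxs
    exact (hx (hsub (Set.uIoc_subset_uIcc hxs))).deriv
  refine ⟨hac'.intervalIntegrable_deriv.congr_ae ?_, ?_⟩
  · exact (ae_restrict_iff' measurableSet_uIoc).2 hd
  · rw [← intervalIntegral.integral_congr_ae hd, hac'.integral_deriv_eq_sub]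

theorem tendsto_integral_div_comp_mul (hε : Tendsto ε atTop (𝓝 0)) {l : ℝ} (hl : 0 < l) :
    Tendsto (fun t => ∫ u in t..(l * t), ε u / u) atTop (𝓝 0) := by
  rw [Metric.tendsto_atTop]
  intro e he
  -- Whether `l` is below or above 1, the interval of integration lies in `[m t, ∞)`.
  set m := min 1 l with hm
  have hmpos : 0 < m := by positivity
  set η := e * m / (2 * (|l - 1| + 1)) with hη
  have hηpos : 0 < η := by positivity
  obtain ⟨S, hS⟩ := Metric.tendsto_atTop.1 hε η hηpos
  refine ⟨max 1 (S / m), fun t ht => ?_⟩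
  have htpos : 0 < t := by linarith [(le_max_left 1 (S / m)).trans ht]
  have hSt : S ≤ m * t := by
    have := (le_max_right 1 (S / m)).trans ht
    rwa [div_le_iff₀ hmpos, mul_comm] at this
  have hb : ∀ u ∈ Set.uIoc t (l * t), ‖ε u / u‖ ≤ η / (m * t) := by
    intro u hu
    have hmu : m * t ≤ u := by
      refine le_trans ?_ (le_of_lt hu.1)
      refine le_min ?_ ?_
      · exact mul_le_of_le_one_left htpos.le (min_le_left _ _)
      · exact mul_le_mul_of_nonneg_right (min_le_right _ _) htpos.le
    have h1 := hS u (hSt.trans hmu)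
    rw [dist_zero_right] at h1
    have hmt : 0 < m * t := by positivity
    rw [norm_div, Real.norm_of_nonneg (hmt.le.trans hmu)]
    gcongr
  have h2 := intervalIntegral.norm_integral_le_of_norm_le_const hb
  rw [dist_zero_right]
  refine h2.trans_lt ?_
  have e1 : |l * t - t| = |l - 1| * t := by
    rw [show l * t - t = (l - 1) * t by ring, abs_mul, abs_of_pos htpos]
  rw [e1]
  have e2 : η / (m * t) * (|l - 1| * t) = e * (|l - 1| / (2 * (|l - 1| + 1))) := by
    rw [hη]; field_simp
  rw [e2]
  have : |l - 1| / (2 * (|l - 1| + 1)) < 1 := by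
    rw [div_lt_one (by positivity)]
    linarith [abs_nonneg (l - 1)]
  nlinarith

theorem tendsto_div_of_representation (ha : 0 < a) (hc : c ≠ 0) (hε : Tendsto ε atTop (𝓝 0))
    (hint : ∀ t ≥ a, IntervalIntegrable (fun u => ε u / u) volume a t)
    (hg : ∀ t ≥ a, g t = t ^ ρ * c * Real.exp (∫ u in a..t, ε u / u)) {l : ℝ} (hl : 0 < l) :
    Tendsto (fun t => g (l * t) / g t) atTop (𝓝 (l ^ ρ)) := by
  have h1 := ((Real.continuous_exp.tendsto 0).comp (tendsto_integral_div_comp_mul hε hl)).const_mul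
    (l ^ ρ)
  rw [Real.exp_zero, mul_one] at h1
  refine h1.congr' ?_
  filter_upwards [eventually_ge_atTop a, eventually_ge_atTop (a / l)] with t ht1 ht2
  rw [div_le_iff₀ hl, mul_comm] at ht2
  have htpos : 0 < t := ha.trans_le ht1
  have hr : 0 < t ^ ρ := Real.rpow_pos_of_pos htpos _
  rw [hg t ht1, hg _ ht2, Real.mul_rpow hl.le htpos.le, Function.comp_apply,
    ← intervalIntegral.integral_interval_sub_left (hint _ ht2) (hint _ ht1), Real.exp_sub]
  field_simp

/-- Eventually `ε < -ρ/2`, so the exponential grows at most like `t ^ (-ρ/2)`, leaving `g = O(t ^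
(ρ/2))`. -/
theorem tendsto_zero_of_representation (ha : 0 < a) (hρ : ρ < 0) (hε : Tendsto ε atTop (𝓝 0))
    (hint : ∀ t ≥ a, IntervalIntegrable (fun u => ε u / u) volume a t)
    (hg : ∀ t ≥ a, g t = t ^ ρ * c * Real.exp (∫ u in a..t, ε u / u)) :
    Tendsto g atTop (𝓝 0) := by
  obtain ⟨S, hS⟩ := eventually_atTop.1 (hε.eventually (gt_mem_nhds (show 0 < -ρ / 2 by linarith)))
  set b := max a S with hb
  have hab : a ≤ b := le_max_left _ _
  have hbpos : 0 < b := ha.trans_le hab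
  set A := ∫ u in a..b, ε u / u with hA
  have hlim : Tendsto (fun t : ℝ => |c| * Real.exp (A - -ρ / 2 * Real.log b) * t ^ (-(-ρ / 2)))
      atTop (𝓝 0) := by
    simpa using (tendsto_rpow_neg_atTop (show 0 < -ρ / 2 by linarith)).const_mul
      (|c| * Real.exp (A - -ρ / 2 * Real.log b))
  refine squeeze_zero_norm' ?_ hlim
  filter_upwards [eventually_ge_atTop b] with t ht
  have htpos : 0 < t := hbpos.trans_le ht
  have hbt : IntervalIntegrable (fun u => ε u / u) volume b t :=
    (hint b hab).symm.trans (hint t (hab.trans ht))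
  have hle : ∫ u in b..t, ε u / u ≤ -ρ / 2 * (Real.log t - Real.log b) := by
    rw [← Real.log_div htpos.ne' hbpos.ne', ← integral_inv_of_pos hbpos htpos,
      ← intervalIntegral.integral_const_mul]
    refine intervalIntegral.integral_mono_on ht hbt ?_ fun u hu => ?_
    · refine IntervalIntegrable.const_mul ?_ _
      refine intervalIntegral.intervalIntegrable_inv (fun u hu => ?_) continuousOn_id
      rw [Set.uIcc_of_le ht] at hu
      exact (hbpos.trans_le hu.1).ne'
    · have : 0 < u := hbpos.trans_le hu.1
      rw [div_eq_mul_inv]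
      exact mul_le_mul_of_nonneg_right (hS u ((le_max_right _ _).trans hu.1)).le (by positivity)
  rw [hg t (hab.trans ht), norm_mul, norm_mul, Real.norm_eq_abs c,
    Real.norm_of_nonneg (Real.rpow_nonneg htpos.le _), Real.norm_of_nonneg (Real.exp_pos _).le,
    ← intervalIntegral.integral_add_adjacent_intervals (hint b hab) hbt, mul_comm _ |c|,
    mul_assoc, mul_assoc]
  refine mul_le_mul_of_nonneg_left ?_ (abs_nonneg _)
  rw [Real.rpow_def_of_pos htpos, Real.rpow_def_of_pos htpos, ← Real.exp_add, ← Real.exp_add]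
  refine Real.exp_le_exp.2 ?_
  rw [← hA]
  linarith

end Representation

theorem NormalizedRegularlyVarying.ultimatelyACWithRVDensity {g : ℝ → ℝ} {β : ℝ} (hβ : 0 < β)
    (h : NormalizedRegularlyVarying g (-β)) :
    UltimatelyACWithRVDensity g (-β - 1) ∧ Tendsto g atTop (𝓝 0) := by
  obtain ⟨a, ha, c, hc, ε, hε, hint, hg⟩ := h
  refine ⟨⟨a, fun b hb => absolutelyContinuousOnInterval_of_representation ha hint hg hb, _,
    isDensityOn_of_representation ha hint hg, ?_⟩,
    tendsto_zero_of_representation ha (neg_lt_zero.2 hβ) hε hint hg⟩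
  -- Beyond `S` the factor `ε - β` is negative, so the density has the sign opposite to `c`.
  obtain ⟨S, hS⟩ := eventually_atTop.1 (hε.eventually (gt_mem_nhds hβ))
  refine ⟨⟨max a S, ?_, ?_⟩, fun l hl => ?_⟩
  · have hdens := isDensityOn_of_representation ha hint hg
    have hIci : Set.Ici (max a S) ⊆ ⋃ n : ℕ, Set.Icc a (a + n) := by
      intro x hx
      obtain ⟨n, hn⟩ := exists_nat_ge (x - a)
      exact Set.mem_iUnion.2 ⟨n, (le_max_left _ _).trans hx, by linarith⟩
    refine AEMeasurable.mono_set hIci (aemeasurable_iUnion_iff.2 fun n => ?_)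
    have hn : a ≤ a + n := by linarith [n.cast_nonneg (α := ℝ)]
    exact (((intervalIntegrable_iff_integrableOn_Icc_of_le hn).1
      (hdens a le_rfl _ hn).1).aestronglyMeasurable).aemeasurable
  · have key : ∀ t ≥ max a S, ∃ r > 0, g t * (ε t + -β) / t = -c * r := by
      intro t ht
      have hta : a ≤ t := (le_max_left _ _).trans ht
      have htpos : 0 < t := ha.trans_le hta
      have hεt := hS t ((le_max_right _ _).trans ht)
      refine ⟨t ^ (-β) * Real.exp (∫ u in a..t, ε u / u) * (β - ε t) / t, ?_, ?_⟩
      · have : 0 < β - ε t := by linarith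
        have := Real.rpow_pos_of_pos htpos (-β)
        positivity
      · rw [hg t hta]; ring
    rcases lt_or_gt_of_ne hc with h0 | h0
    · left
      intro t ht
      obtain ⟨r, hr, h1⟩ := key t ht
      beta_reduce
      rw [h1]
      nlinarith
    · right
      intro t ht
      obtain ⟨r, hr, h1⟩ := key t ht
      beta_reduce
      rw [h1]
      nlinarith
  · have h1 := tendsto_div_of_representation ha hc hε hint hg hl
    have h2 : Tendsto (fun t => ε t + -β) atTop (𝓝 (-β)) := by simpa using hε.add_const (-β)
    have h3 := h2.comp (tendsto_id.const_mul_atTop hl)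
    have h4 := (h1.mul (h3.div h2 (by linarith))).div_const l
    rw [div_self (by linarith : -β ≠ 0), mul_one, ← Real.rpow_sub_one hl.ne'] at h4
    refine h4.congr' ?_
    filter_upwards [eventually_gt_atTop 0] with t ht
    simp only [Pi.div_apply, Function.comp_apply, id]
    field_simp

/-! ### Uniform convergence for regularly varying functions -/

/-- Pointwise convergence along `z` makes these sets increase to `[1, 4]`, which has length 3. -/
theorem tendsto_volume_setOf_forall_ge {h : ℝ → ℝ} {z : ℕ → ℝ} {ε : ℝ} (hε : 0 < ε)
    (hz : Tendsto z atTop atTop)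
    (hlim : ∀ l : ℝ, 0 < l → Tendsto (fun t => h (l * t) - h t) atTop (𝓝 0)) :
    Tendsto (fun n => volume {y ∈ Set.Icc (1 : ℝ) 4 | ∀ m ≥ n, |h (y * z m) - h (z m)| < ε})
      atTop (𝓝 3) := by
  have hmono : Monotone fun n : ℕ =>
      {y ∈ Set.Icc (1 : ℝ) 4 | ∀ m ≥ n, |h (y * z m) - h (z m)| < ε} :=
    fun n n' hn y hy => ⟨hy.1, fun m hm => hy.2 m (le_trans hn hm)⟩
  have h1 := tendsto_measure_iUnion_atTop (μ := volume) hmono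
  have h2 : ⋃ n : ℕ, {y ∈ Set.Icc (1 : ℝ) 4 | ∀ m ≥ n, |h (y * z m) - h (z m)| < ε}
      = Set.Icc (1 : ℝ) 4 := by
    refine Set.Subset.antisymm (Set.iUnion_subset fun n y hy => hy.1) fun y hy => ?_
    have h3 := ((hlim y (by linarith [hy.1])).comp hz).eventually (Metric.ball_mem_nhds 0 hε)
    obtain ⟨n, hn⟩ := eventually_atTop.1 h3
    exact Set.mem_iUnion.2 ⟨n, hy, fun m hm => by simpa using hn m hm⟩
  rw [h2, Real.volume_Icc] at h1
  norm_num at h1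
  exact h1

theorem nullMeasurableSet_setOf_forall_ge {h : ℝ → ℝ} {a ε : ℝ} {z : ℕ → ℝ}
    (hm : AEMeasurable h (volume.restrict (Set.Ici a))) (hz0 : ∀ n, 0 < z n) (hza : ∀ n, a ≤ z n)
    (n : ℕ) :
    NullMeasurableSet {y ∈ Set.Icc (1 : ℝ) 4 | ∀ m ≥ n, |h (y * z m) - h (z m)| < ε} := by
  have h1 : {y ∈ Set.Icc (1 : ℝ) 4 | ∀ m ≥ n, |h (y * z m) - h (z m)| < ε} =
      Set.Icc (1 : ℝ) 4 ∩ ⋂ m : ℕ, ⋂ _ : m ≥ n,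
        ({y | |h (y * z m) - h (z m)| < ε} ∩ Set.Icc (1 : ℝ) 4) := by
    ext y
    simp only [Set.mem_ofPred_eq, Set.mem_inter_iff, Set.mem_iInter]
    exact ⟨fun hy => ⟨hy.1, fun m hm => ⟨hy.2 m hm, hy.1⟩⟩,
      fun hy => ⟨hy.1, fun m hm => (hy.2 m hm).1⟩⟩
  rw [h1]
  refine measurableSet_Icc.nullMeasurableSet.inter
    (NullMeasurableSet.iInter fun m => NullMeasurableSet.iInter fun _ => ?_)
  refine (nullMeasurableSet_restrict measurableSet_Icc.nullMeasurableSet).1 ?_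
  have hmaps : Set.MapsTo (z m • ·) (Set.Icc (1 : ℝ) 4) (Set.Ici a) := by
    intro y hy
    simp only [smul_eq_mul, Set.mem_Ici]
    nlinarith [hy.1, hz0 m, hza m]
  have h2 := hm.comp_quasiMeasurePreserving
    ((Measure.quasiMeasurePreserving_smul (μ := (volume : Measure ℝ)) (hz0 m).ne').restrict hmaps)
  have h3 : AEMeasurable (fun y => |h (y * z m) - h (z m)|)
      (volume.restrict (Set.Icc (1 : ℝ) 4)) := by
    have h4 : AEMeasurable (fun y => h (y * z m)) (volume.restrict (Set.Icc (1 : ℝ) 4)) := by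
      simpa [Function.comp_def, mul_comm] using h2
    exact (h4.sub_const _).abs
  exact h3.nullMeasurable measurableSet_Iio

open scoped Pointwise in
/-- **Uniform convergence theorem** for slowly varying functions, in additive form. -/
theorem eventually_forall_abs_sub_le {h : ℝ → ℝ} {a : ℝ}
    (hm : AEMeasurable h (volume.restrict (Set.Ici a)))
    (hlim : ∀ l : ℝ, 0 < l → Tendsto (fun t => h (l * t) - h t) atTop (𝓝 0)) {ε : ℝ}
    (hε : 0 < ε) : ∀ᶠ t in atTop, ∀ v ∈ Set.Icc (1 : ℝ) 2, |h (v * t) - h t| ≤ ε := by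
  by_contra hcon
  rw [not_eventually, frequently_atTop] at hcon
  choose! x hx using fun n : ℕ => hcon (max n (max a 1))
  obtain ⟨hxge, hx⟩ := forall_and.1 hx
  push Not at hx
  choose u hu hxu using hx
  have hxn : ∀ n : ℕ, (n : ℝ) ≤ x n := fun n => (le_max_left _ _).trans (hxge n)
  have hxa : ∀ n, a ≤ x n := fun n =>
    (le_max_left _ _).trans ((le_max_right _ _).trans (hxge n))
  have hx1 : ∀ n, 1 ≤ x n := fun n =>
    (le_max_right _ _).trans ((le_max_right _ _).trans (hxge n))
  have hxtop : Tendsto x atTop atTop := tendsto_atTop_mono hxn tendsto_natCast_atTop_atTop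
  have hutop : Tendsto (fun n => u n * x n) atTop atTop :=
    tendsto_atTop_mono (fun n => by nlinarith [(hu n).1, hx1 n]) hxtop
  have h1 := tendsto_volume_setOf_forall_ge (half_pos hε) hxtop hlim
  have h2 := tendsto_volume_setOf_forall_ge (half_pos hε) hutop hlim
  -- With `u ≤ 2`, disjoint sets of measure above `5/2` and `5u/2` cannot both fit in `[1, 4u]`:
  -- that would force `u ≥ 7/3`.
  have hlt : ENNReal.ofReal (5 / 2) < 3 := by
    rw [← ENNReal.ofReal_ofNat 3]
    exact (ENNReal.ofReal_lt_ofReal_iff (by norm_num)).2 (by norm_num)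
  obtain ⟨N, hV, hW⟩ := ((h1.eventually (lt_mem_nhds hlt)).and
    (h2.eventually (lt_mem_nhds hlt))).exists
  set V := {y ∈ Set.Icc (1 : ℝ) 4 | ∀ m ≥ N, |h (y * x m) - h (x m)| < ε / 2} with hVdef
  set W := {y ∈ Set.Icc (1 : ℝ) 4 |
    ∀ m ≥ N, |h (y * (u m * x m)) - h (u m * x m)| < ε / 2} with hWdef
  have hVm : NullMeasurableSet V :=
    nullMeasurableSet_setOf_forall_ge hm (fun n => by linarith [hx1 n]) hxa N
  obtain ⟨hu1, hu2⟩ := hu N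
  -- At a common point `y`, the value `h (y * x N)` is within `ε/2` of both `h (x N)` and `h (u N *
  -- x N)`, which differ by more than `ε`.
  have hdisj : Disjoint V (u N • W) := by
    rw [Set.disjoint_left]
    rintro y hyV ⟨w, hw, rfl⟩
    have h3 := hyV.2 N le_rfl
    have h4 := hw.2 N le_rfl
    have e : (fun x => u N • x) w * x N = w * (u N * x N) := by simp only [smul_eq_mul]; ring
    rw [e] at h3
    have h5 := abs_sub_le (h (u N * x N)) (h (w * (u N * x N))) (h (x N))
    rw [abs_sub_comm (h (u N * x N)) (h (w * (u N * x N)))] at h5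
    linarith [hxu N]
  have hsub : V ∪ u N • W ⊆ Set.Icc 1 (u N * 4) := by
    rintro y (hy | ⟨w, hw, rfl⟩)
    · exact ⟨hy.1.1, by linarith [hy.1.2]⟩
    · simp only [smul_eq_mul, Set.mem_Icc]
      constructor <;> nlinarith [hw.1.1, hw.1.2]
  have h3 := measure_mono (μ := volume) hsub
  rw [measure_union₀' hVm hdisj.aedisjoint, Measure.addHaar_smul, Real.volume_Icc,
    Module.finrank_self, pow_one, abs_of_pos (by linarith : 0 < u N)] at h3
  have h4 : ENNReal.ofReal (5 / 2 + u N * (5 / 2)) ≤ ENNReal.ofReal (u N * 4 - 1) := by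
    rw [ENNReal.ofReal_add (by norm_num) (by positivity), ENNReal.ofReal_mul (by linarith)]
    refine le_trans ?_ h3
    gcongr
  rw [ENNReal.ofReal_le_ofReal_iff (by linarith)] at h4
  linarith

theorem abs_sub_le_of_abs_log_sub_le {p q η : ℝ} (hp : 0 < p) (hq : 0 < q) (hη : η ≤ 1)
    (h : |Real.log p - Real.log q| ≤ η) : |p - q| ≤ 2 * η * q := by
  have h1 := Real.abs_exp_sub_one_le (h.trans hη)
  rw [Real.exp_sub, Real.exp_log hp, Real.exp_log hq] at h1
  have h2 : p - q = (p / q - 1) * q := by field_simp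
  rw [h2, abs_mul, abs_of_pos hq]
  exact mul_le_mul_of_nonneg_right (by linarith) hq.le

section RegularVariation

variable {f : ℝ → ℝ} {ρ a : ℝ}

/-- Uniform convergence for a positive regularly varying function, in logarithmic form. -/
theorem RegularlyVarying.eventually_abs_log_sub_le (hf : RegularlyVarying f ρ)
    (hpos : ∀ t ≥ a, 0 < f t) {η : ℝ} (hη : 0 < η) :
    ∀ᶠ t in atTop, ∀ v ∈ Set.Icc (1 : ℝ) 2,
      |Real.log (f (v * t)) - (Real.log (f t) + ρ * Real.log v)| ≤ η := by
  obtain ⟨⟨b, hmeas, -⟩, hlim⟩ := hf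
  have h1 := eventually_forall_abs_sub_le (h := fun t => Real.log (f t) - ρ * Real.log t) (a := b)
    ((Real.measurable_log.comp_aemeasurable hmeas).sub
      (Real.measurable_log.const_mul ρ).aemeasurable) ?_ hη
  · filter_upwards [h1, eventually_gt_atTop 0] with t ht ht0 v hv
    have := ht v hv
    rw [Real.log_mul (by linarith [hv.1]) ht0.ne'] at this
    convert this using 2
    ring
  · intro l hl
    have hl' : 0 < l ^ ρ := Real.rpow_pos_of_pos hl _
    have h2 := ((Real.continuousAt_log hl'.ne').tendsto.comp (hlim l hl)).sub_const
      (ρ * Real.log l)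
    rw [Real.log_rpow hl, sub_self] at h2
    refine h2.congr' ?_
    filter_upwards [eventually_gt_atTop 0, eventually_ge_atTop a, eventually_ge_atTop (a / l)]
      with t ht0 ht1 ht2
    rw [div_le_iff₀ hl, mul_comm] at ht2
    rw [Function.comp_apply, Real.log_div (hpos _ ht2).ne' (hpos _ ht1).ne',
      Real.log_mul hl.ne' ht0.ne']
    ring

theorem RegularlyVarying.eventually_abs_sub_rpow_mul_le (hf : RegularlyVarying f ρ)
    (hpos : ∀ t ≥ a, 0 < f t) {η : ℝ} (hη : 0 < η) :
    ∀ᶠ t in atTop, ∀ v ∈ Set.Icc (1 : ℝ) 2, |f (v * t) - v ^ ρ * f t| ≤ η * (v ^ ρ * f t) := by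
  filter_upwards [hf.eventually_abs_log_sub_le hpos (show 0 < min 1 (η / 2) by positivity),
    eventually_ge_atTop (max a 0)] with t ht hta v hv
  have ht0 : 0 ≤ t := (le_max_right _ _).trans hta
  have hft := hpos t ((le_max_left _ _).trans hta)
  have hv0 : 0 < v := by linarith [hv.1]
  have hvt : a ≤ v * t := ((le_max_left _ _).trans hta).trans (by nlinarith [hv.1])
  have hvr : 0 < v ^ ρ := Real.rpow_pos_of_pos hv0 _
  have h1 := ht v hv
  rw [add_comm, ← Real.log_rpow hv0, ← Real.log_mul hvr.ne' hft.ne'] at h1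
  refine (abs_sub_le_of_abs_log_sub_le (hpos _ hvt) (by positivity) (min_le_left _ _) h1).trans ?_
  refine mul_le_mul_of_nonneg_right ?_ (by positivity)
  linarith [min_le_right 1 (η / 2)]

/-- A positive regularly varying function is nearly constant on `[t(1-δ), t(1+δ)]`. -/
theorem RegularlyVarying.exists_forall_abs_sub_le (hf : RegularlyVarying f ρ)
    (hpos : ∀ t ≥ a, 0 < f t) {η : ℝ} (hη : 0 < η) :
    ∃ δ > 0, δ ≤ 1 / 2 ∧ ∀ᶠ t in atTop, ∀ s, |s - t| ≤ δ * t → |f s - f t| ≤ η * f t := by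
  set e := min 1 (η / 2) with he
  have hepos : 0 < e := by positivity
  have hcont : Tendsto (fun v => ρ * Real.log v) (𝓝 1) (𝓝 0) := by
    simpa using (Real.continuousAt_log one_ne_zero).tendsto.const_mul ρ
  obtain ⟨d, hd, hd1⟩ := Metric.eventually_nhds_iff.1
    (hcont.eventually (Metric.ball_mem_nhds 0 (half_pos hepos)))
  obtain ⟨T, hT⟩ := eventually_atTop.1 (hf.eventually_abs_log_sub_le hpos (half_pos hepos))
  have hδ : 0 < min (1 / 2) (d / 4) := by positivity
  refine ⟨min (1 / 2) (d / 4), hδ, min_le_left _ _, ?_⟩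
  -- Uniform convergence covers only multipliers in `[1, 2]`, so the comparison starts from the
  -- smaller point; the two orders are merged afterwards.
  have key : ∀ s t, max T (max a 1) ≤ s → s ≤ t → t ≤ 2 * s → t - s < d * s →
      |Real.log (f t) - Real.log (f s)| ≤ e := by
    intro s t hs hst ht2 htd
    have hs0 : 0 < s := by
      linarith [(le_max_right a 1).trans ((le_max_right T (max a 1)).trans hs)]
    have h1 := hT s ((le_max_left _ _).trans hs) (t / s)
      ⟨by rwa [le_div_iff₀ hs0, one_mul], by rwa [div_le_iff₀ hs0]⟩
    rw [div_mul_cancel₀ _ hs0.ne'] at h1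
    have h2 : |ρ * Real.log (t / s)| < e / 2 := by
      have := hd1 (y := t / s) (by
        rw [Real.dist_eq, show t / s - 1 = (t - s) / s by field_simp,
          abs_of_nonneg (div_nonneg (by linarith) hs0.le), div_lt_iff₀ hs0]
        exact htd)
      simpa using this
    have h3 := abs_add_le (Real.log (f t) - (Real.log (f s) + ρ * Real.log (t / s)))
      (ρ * Real.log (t / s))
    rw [show Real.log (f t) - (Real.log (f s) + ρ * Real.log (t / s)) + ρ * Real.log (t / s) =
      Real.log (f t) - Real.log (f s) by ring] at h3
    linarith
  filter_upwards [eventually_ge_atTop (2 * max T (max a 1))] with t ht s hs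
  have hM1 : 1 ≤ max T (max a 1) := (le_max_right a 1).trans (le_max_right _ _)
  have hMa : a ≤ max T (max a 1) := (le_max_left a 1).trans (le_max_right _ _)
  have ht0 : 0 < t := by linarith
  have hs1 : |s - t| ≤ 1 / 2 * t :=
    hs.trans (mul_le_mul_of_nonneg_right (min_le_left _ _) ht0.le)
  have hs2 : |s - t| ≤ d / 4 * t :=
    hs.trans (mul_le_mul_of_nonneg_right (min_le_right _ _) ht0.le)
  rw [abs_le] at hs1 hs2
  have hsM : max T (max a 1) ≤ s := by linarith
  have hlog : |Real.log (f s) - Real.log (f t)| ≤ e := by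
    rcases le_total s t with hst | hst
    · rw [abs_sub_comm]
      exact key s t hsM hst (by linarith) (by nlinarith)
    · exact key t s (by linarith) hst (by linarith) (by nlinarith)
  have hft := hpos t (by linarith)
  refine (abs_sub_le_of_abs_log_sub_le (hpos s (by linarith)) hft (min_le_left _ _) hlog).trans ?_
  refine mul_le_mul_of_nonneg_right ?_ hft.le
  linarith [min_le_right 1 (η / 2)]

end RegularVariation

/-! ### Karamata's theorem and the return to difference quotients -/

/-- The bounds telescope along `2 ^ n * t`, and both `A` and `F` vanish in the limit, `F` by
geometric decay. -/
theorem abs_sub_le_mul_of_doubling {A F : ℝ → ℝ} {r η T : ℝ} (hT : 0 < T) (hr0 : 0 ≤ r)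
    (hr : r < 1) (hA : Tendsto A atTop (𝓝 0)) (hF : ∀ t ≥ T, 0 ≤ F t)
    (hF2 : ∀ t ≥ T, F (2 * t) ≤ r * F t) (hη : 0 ≤ η)
    (h : ∀ t ≥ T, |(A t - F t) - (A (2 * t) - F (2 * t))| ≤ η * (F t - F (2 * t))) :
    ∀ t ≥ T, |A t - F t| ≤ η * F t := by
  intro t ht
  have ht0 : 0 < t := hT.trans_le ht
  have hge : ∀ n : ℕ, T ≤ 2 ^ n * t := fun n => by
    have : (1 : ℝ) ≤ 2 ^ n := one_le_pow₀ (by norm_num)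
    nlinarith
  have hsucc : ∀ n : ℕ, (2 : ℝ) ^ (n + 1) * t = 2 * (2 ^ n * t) := fun n => by ring
  have hgeom : ∀ n : ℕ, F (2 ^ n * t) ≤ r ^ n * F t := by
    intro n
    induction n with
    | zero => simp
    | succ n ih =>
      rw [hsucc, pow_succ', mul_assoc]
      exact (hF2 _ (hge n)).trans (mul_le_mul_of_nonneg_left ih hr0)
  have htel : ∀ n : ℕ, |(A t - F t) - (A (2 ^ n * t) - F (2 ^ n * t))| ≤ η * F t := by
    have : ∀ n : ℕ, |(A t - F t) - (A (2 ^ n * t) - F (2 ^ n * t))|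
        ≤ η * (F t - F (2 ^ n * t)) := by
      intro n
      induction n with
      | zero => simp
      | succ n ih =>
        rw [hsucc]
        have h1 := h _ (hge n)
        refine (abs_sub_le _ (A (2 ^ n * t) - F (2 ^ n * t)) _).trans ?_
        linarith
    intro n
    refine (this n).trans (mul_le_mul_of_nonneg_left ?_ hη)
    linarith [hF _ (hge n)]
  have hFlim : Tendsto (fun n : ℕ => F (2 ^ n * t)) atTop (𝓝 0) := by
    refine squeeze_zero (fun n => hF _ (hge n)) hgeom ?_
    simpa using (tendsto_pow_atTop_nhds_zero_of_lt_one hr0 hr).mul_const (F t)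
  have hAlim : Tendsto (fun n : ℕ => A (2 ^ n * t)) atTop (𝓝 0) :=
    hA.comp ((tendsto_pow_atTop_atTop_of_one_lt (by norm_num)).atTop_mul_const ht0)
  have hlim := ((hAlim.sub hFlim).const_sub (A t - F t)).abs
  rw [sub_self, sub_zero] at hlim
  exact le_of_tendsto' hlim htel

section Karamata

variable {g f : ℝ → ℝ} {β a b : ℝ}

/-- Integrate `f (v * t) ≈ v ^ (-β - 1) * f t` over `v ∈ [1, 2]`. -/
theorem eventually_abs_increment_sub_le (hβ : 0 < β) (hd : IsDensityOn g f a)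
    (hf : RegularlyVarying f (-β - 1)) (hpos : ∀ t ≥ b, 0 < f t) {η : ℝ} (hη : 0 < η) :
    ∀ᶠ t in atTop, |β * (g (2 * t) - g t) - (1 - 2 ^ (-β)) * (t * f t)| ≤ η * (t * f t) := by
  filter_upwards [hf.eventually_abs_sub_rpow_mul_le hpos (show 0 < η / β by positivity),
    eventually_ge_atTop a, eventually_ge_atTop b, eventually_gt_atTop 0] with t ht hta htb ht0
  have hft := hpos t htb
  obtain ⟨hint, heq⟩ := hd t hta (2 * t) (by linarith)
  have h1 : IntervalIntegrable (fun v => f (v * t)) volume 1 2 := by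
    have := hint.comp_mul_right (c := t)
    rwa [div_self ht0.ne', mul_div_cancel_right₀ _ ht0.ne'] at this
  have h2 : IntervalIntegrable (fun v : ℝ => v ^ (-β - 1) * f t) volume 1 2 := by
    refine (intervalIntegral.intervalIntegrable_rpow (Or.inr ?_)).mul_const _
    rw [Set.uIcc_of_le (by norm_num)]
    exact fun h => by linarith [h.1]
  have h3 : ∫ v in (1 : ℝ)..2, f (v * t) = t⁻¹ * (g (2 * t) - g t) := by
    rw [heq, intervalIntegral.integral_comp_mul_right _ ht0.ne', one_mul, smul_eq_mul]
  have h4 : ∫ v in (1 : ℝ)..2, v ^ (-β - 1) * f t = (1 - 2 ^ (-β)) / β * f t := by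
    rw [intervalIntegral.integral_mul_const, integral_rpow, Real.one_rpow]
    · rw [show -β - 1 + 1 = -β by ring]
      congr 1
      field_simp
      ring
    · refine Or.inr ⟨by linarith, ?_⟩
      rw [Set.uIcc_of_le (by norm_num)]
      exact fun h => by linarith [h.1]
  have h5 : ‖∫ v in (1 : ℝ)..2, (f (v * t) - v ^ (-β - 1) * f t)‖ ≤ η / β * f t * |2 - 1| := by
    refine intervalIntegral.norm_integral_le_of_norm_le_const fun v hv => ?_
    rw [Set.uIoc_of_le (by norm_num)] at hv
    refine (ht v ⟨hv.1.le, hv.2⟩).trans ?_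
    have : v ^ (-β - 1) ≤ 1 := Real.rpow_le_one_of_one_le_of_nonpos hv.1.le (by linarith)
    refine mul_le_mul_of_nonneg_left ?_ (by positivity)
    nlinarith
  rw [intervalIntegral.integral_sub h1 h2, h3, h4, Real.norm_eq_abs] at h5
  have h6 : β * (g (2 * t) - g t) - (1 - 2 ^ (-β)) * (t * f t) =
      β * t * (t⁻¹ * (g (2 * t) - g t) - (1 - 2 ^ (-β)) / β * f t) := by
    field_simp
  rw [h6, abs_mul, abs_of_pos (by positivity)]
  refine (mul_le_mul_of_nonneg_left h5 (by positivity)).trans (le_of_eq ?_)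
  norm_num
  field_simp

/-- Karamata's theorem: `t f(t) / ∫_t^∞ f → β`, with `-g(t) = ∫_t^∞ f`. -/
theorem eventually_abs_neg_mul_sub_le (hβ : 0 < β) (hd : IsDensityOn g f a)
    (hf : RegularlyVarying f (-β - 1)) (hpos : ∀ t ≥ b, 0 < f t) (hg : Tendsto g atTop (𝓝 0))
    {η : ℝ} (hη : 0 < η) : ∀ᶠ t in atTop, |β * -g t - t * f t| ≤ η * (t * f t) := by
  set q : ℝ := 2 ^ (-β) with hq
  have hq0 : 0 < q := by positivity
  have hq1 : q < 1 := Real.rpow_lt_one_of_one_lt_of_neg (by norm_num) (by linarith)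
  have h1q : 0 < 1 - q := by linarith
  -- With `F(t) = t f(t)`, the first term gives the ratio `q + e < 1` and `F(t) - F(2t) ≥ (1-q)/2 *
  -- F(t)`. The second absorbs two errors `e * F(t)`, one from the increment of `g` and one from
  -- `F(2t) ≈ q F(t)`.
  set e := min ((1 - q) / 2) (η * ((1 - q) / 2) / 2) with he
  have he0 : 0 < e := by positivity
  have he1 : e ≤ (1 - q) / 2 := min_le_left _ _
  have he2 : e ≤ η * ((1 - q) / 2) / 2 := min_le_right _ _
  obtain ⟨T, hT⟩ := eventually_atTop.1 ((eventually_abs_increment_sub_le hβ hd hf hpos he0).and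
    (hf.eventually_abs_sub_rpow_mul_le hpos he0))
  set S := max T (max b 1) with hS
  have hS0 : 0 < S := by positivity
  have hpos' : ∀ t ≥ S, 0 < t * f t := fun t ht =>
    mul_pos (hS0.trans_le ht)
      (hpos t ((le_max_left _ _).trans ((le_max_right T (max b 1)).trans ht)))
  have hstep : ∀ t ≥ S, |2 * t * f (2 * t) - q * (t * f t)| ≤ e * (t * f t) := by
    intro t ht
    have ht0 : 0 < t := hS0.trans_le ht
    have h1 := (hT t ((le_max_left _ _).trans ht)).2 2 ⟨by norm_num, le_rfl⟩
    have hq2 : (2 : ℝ) ^ (-β - 1) = q / 2 := Real.rpow_sub_one (by norm_num) _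
    rw [hq2] at h1
    have e1 : 2 * t * f (2 * t) - q * (t * f t) = 2 * t * (f (2 * t) - q / 2 * f t) := by ring
    rw [e1, abs_mul, abs_of_pos (by positivity)]
    have h2 := mul_le_mul_of_nonneg_left h1 (show 0 ≤ 2 * t by positivity)
    have h3 : q * (e * (t * f t)) ≤ 1 * (e * (t * f t)) :=
      mul_le_mul_of_nonneg_right hq1.le (mul_nonneg he0.le (hpos' t ht).le)
    linarith
  have main := abs_sub_le_mul_of_doubling (A := fun t => β * -g t) (F := fun t => t * f t)
    (r := q + e) (η := η) hS0 (by linarith) (by linarith) (by simpa using hg.neg.const_mul β)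
    (fun t ht => (hpos' t ht).le) ?_ hη.le ?_
  · filter_upwards [eventually_ge_atTop S] with t ht using main t ht
  · intro t ht
    have h1 := (abs_le.1 (hstep t ht)).2
    linarith
  · intro t ht
    have h0 := hpos' t ht
    have h1 := abs_le.1 (hstep t ht)
    have h2 := abs_le.1 (hT t ((le_max_left _ _).trans ht)).1
    have h3 : e * (t * f t) ≤ (1 - q) / 2 * (t * f t) := mul_le_mul_of_nonneg_right he1 h0.le
    have h4 : e * (t * f t) ≤ η * ((1 - q) / 2) / 2 * (t * f t) :=
      mul_le_mul_of_nonneg_right he2 h0.le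
    have h5 : (1 - q) / 2 * (t * f t) ≤ t * f t - 2 * t * f (2 * t) := by linarith [h1.2]
    have h6 := mul_le_mul_of_nonneg_left h5 hη.le
    refine abs_le.2 ⟨?_, ?_⟩ <;> linarith [h1.1, h1.2, h2.1, h2.2]

theorem deltaOne_of_density_pos (hβ : 0 < β) (hd : IsDensityOn g f a)
    (hf : RegularlyVarying f (-β - 1)) (hpos : ∀ t ≥ b, 0 < f t) (hg : Tendsto g atTop (𝓝 0)) :
    DeltaOne g β := by
  -- A crude case of Karamata's theorem: it forces `g < 0` and converts errors relative to `t f(t)`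
  -- into errors relative to `-g(t)`.
  have hlow : ∀ᶠ t in atTop, 0 < t * f t ∧ t * f t ≤ 2 * (β * -g t) := by
    filter_upwards [eventually_abs_neg_mul_sub_le hβ hd hf hpos hg (show (0 : ℝ) < 1 / 2 by norm_num),
      eventually_gt_atTop 0, eventually_ge_atTop b] with t ht ht0 htb
    have := (abs_le.1 ht).1
    exact ⟨mul_pos ht0 (hpos t htb), by linarith⟩
  refine deltaOne_iff.2 ⟨?_, fun η hη => ?_⟩
  · filter_upwards [hlow] with t ht h0
    rw [h0] at ht
    linarith [ht.1, ht.2]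
  -- Near constancy of `f` and Karamata's theorem each cost `e |x| t f(t)`, and `t f(t) ≤
  -- 2β(-g(t))`, for a total of `η |x| (-g(t))`.
  · set e := η / (4 * β) with he
    have he0 : 0 < e := by positivity
    obtain ⟨δ, hδ, hδ2, h1⟩ := hf.exists_forall_abs_sub_le hpos he0
    refine ⟨δ, hδ, ?_⟩
    filter_upwards [hlow, h1, eventually_abs_neg_mul_sub_le hβ hd hf hpos hg he0,
      eventually_gt_atTop 0, eventually_ge_atTop (2 * a), eventually_ge_atTop a]
      with t ⟨hF0, hF⟩ ht2 ht3 ht0 ht2a hta x hx0 hxδ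
    have hx : x ≠ 0 := abs_pos.1 hx0
    have hgneg : 0 < -g t := by
      by_contra hcon
      push Not at hcon
      nlinarith
    have hxb := abs_lt.1 (hxδ.trans_le hδ2)
    have hsa : a ≤ t * (1 - x) := by nlinarith
    have hint : IntervalIntegrable f volume t (t * (1 - x)) ∧
        g (t * (1 - x)) - g t = ∫ u in t..(t * (1 - x)), f u := by
      rcases le_total t (t * (1 - x)) with hle | hle
      · exact hd t hta _ hle
      · obtain ⟨h2, h3⟩ := hd _ hsa t hle
        exact ⟨h2.symm, by rw [intervalIntegral.integral_symm, ← h3]; ring⟩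
    have hdist : |t * (1 - x) - t| = t * |x| := by
      rw [show t * (1 - x) - t = -(t * x) by ring, abs_neg, abs_mul, abs_of_pos ht0]
    have h4 : ‖∫ u in t..(t * (1 - x)), (f u - f t)‖ ≤ e * f t * |t * (1 - x) - t| := by
      refine intervalIntegral.norm_integral_le_of_norm_le_const fun u hu => ht2 u ?_
      refine (Set.abs_sub_left_of_mem_uIcc (Set.uIoc_subset_uIcc hu)).trans ?_
      rw [hdist, mul_comm]
      exact mul_le_mul_of_nonneg_right hxδ.le ht0.le
    rw [intervalIntegral.integral_sub hint.1 intervalIntegrable_const, ← hint.2,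
      intervalIntegral.integral_const, hdist, Real.norm_eq_abs, smul_eq_mul] at h4
    rw [smoothDelta_one g t hx]
    have hgt : g t ≠ 0 := by linarith
    have h5 : (g (t * (1 - x)) - g t) / (x * g t) - β =
        ((g (t * (1 - x)) - g t - (t * (1 - x) - t) * f t) + x * (β * -g t - t * f t)) /
          (x * g t) := by
      field_simp
      ring
    rw [h5, abs_div, abs_mul x (g t), abs_of_neg (by linarith : g t < 0),
      div_le_iff₀ (by positivity)]
    refine (abs_add_le _ _).trans ?_
    rw [abs_mul x]
    have h6 := mul_le_mul_of_nonneg_left ht3 hx0.le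
    have h7 : |x| * (2 * e * (t * f t)) ≤ |x| * (2 * e * (2 * (β * -g t))) := by gcongr
    have h8 : |x| * (2 * e * (2 * (β * -g t))) = η * (|x| * -g t) := by
      rw [he]; field_simp; ring
    linarith

end Karamata

/-! ### Reduction to a positive density, and the equivalence -/

theorem DeltaOne.of_neg {g : ℝ → ℝ} {β : ℝ} (h : DeltaOne (fun t => -g t) β) : DeltaOne g β := by
  have e : ∀ t x, smoothDelta 1 (fun t => -g t) t x = smoothDelta 1 g t x := fun t x => by
    unfold smoothDelta
    rw [mul_neg, show Real.sign x * (-g (t * (1 - x)) - -g t) =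
      -(Real.sign x * (g (t * (1 - x)) - g t)) by ring, neg_div_neg_eq]
  unfold DeltaOne at h ⊢
  simpa only [e, neg_ne_zero] using h

theorem RegularlyVarying.neg {f : ℝ → ℝ} {ρ : ℝ} (h : RegularlyVarying f ρ) :
    RegularlyVarying (fun t => -f t) ρ := by
  obtain ⟨⟨a, hm, hs⟩, hl⟩ := h
  refine ⟨⟨a, hm.neg, ?_⟩, fun l hl0 => by simpa only [neg_div_neg_eq] using hl l hl0⟩
  simpa only [neg_pos, neg_lt_zero] using hs.symm

theorem UltimatelyACWithRVDensity.deltaOne {g : ℝ → ℝ} {β : ℝ} (hβ : 0 < β)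
    (h : UltimatelyACWithRVDensity g (-β - 1)) (hg : Tendsto g atTop (𝓝 0)) : DeltaOne g β := by
  obtain ⟨a, -, f, hd, hf⟩ := h
  obtain ⟨b, -, hpos | hneg⟩ := hf.1
  · exact deltaOne_of_density_pos hβ hd hf hpos hg
  · refine DeltaOne.of_neg (deltaOne_of_density_pos (f := fun t => -f t) (a := a) (b := b) hβ
      (fun s hs t ht => ?_) hf.neg (fun t ht => neg_pos.2 (hneg t ht)) (by simpa using hg.neg))
    obtain ⟨h1, h2⟩ := hd s hs t ht
    exact ⟨h1.neg, by rw [intervalIntegral.integral_neg, ← h2]; ring⟩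

theorem proposition2p2p2 (g : ℝ → ℝ) (β : ℝ) (hβ : 0 < β) :
    List.TFAE
      [DeltaOne g β,
       NormalizedRegularlyVarying g (-β),
       UltimatelyACWithRVDensity g (-β - 1) ∧ Tendsto g atTop (𝓝 0)] := by
  tfae_have 1 → 2 := DeltaOne.normalizedRegularlyVarying hβ
  tfae_have 2 → 3 := NormalizedRegularlyVarying.ultimatelyACWithRVDensity hβ
  tfae_have 3 → 1 := fun h => h.1.deltaOne hβ h.2
  tfae_finish
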